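/- Conventions. Let $I=[0,1]$. The (unreduced) suspension $\Sigma B$ is the quotient of $B\times I$ that collapses $B\times\{0\}$ to one point and $B\times\{1\}$ to another. For a map $p\colon X\to Y$ and $y\in Y$, the homotopy fiber over $y$ is $\{(x,\gamma)\in X\times Y^I\mid \gamma(0)=p(x),\ \gamma(1)=y\}$; a sequence $F\xrightarrow{j}X\xrightarrow{p}Y$ is a homotopy fibration if, for some $y\in Y$, there is a homotopy equivalence from $F$ to the homotopy fiber over $y$ whose composite with the projection to $X$ is homotopic to $j$. The sectional category $\mathsf{secat}(f)$ of a map $f\colon X\to Y$ is the least $k$ such that $Y$ is covered by open sets $U_0,\dots,U_k$ over each of which $f$ has a right homotopy inverse ($\infty$ if there is no such $k$). For a map $p\colon X\to Y$, the parametrized topological complexity is $\mathsf{TC}[X\to Y]=\mathsf{secat}(\Delta)$, where $\Delta\colon X\to X\times^h_YX$, $x\mapsto(x,\mathrm{const}_{p(x)},x)$, is the diagonal map into the homotopy fiber product $X\times^h_YX=\{(x,\gamma,x')\in X\times Y^I\times X\mid\gamma(0)=p(x),\ \gamma(1)=p(x')\}$. When $p$ is a (Hurewicz) fibration, $\mathsf{TC}[X\to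 Y]$ is also defined directly as the least $k$ such that the fiberwise product $X\times_YX$ is covered by open sets $U_0,\dots,U_k$, over each of which the map $\Pi\colon X_Y^I\to X\times_YX$, $\gamma\mapsto(\gamma(0),\gamma(1))$, has a continuous section, where $X_Y^I\subseteq X^I$ is the space of paths that stay in a single fiber of $p$ ($\infty$ if there is no such $k$). Proposition 2.6. Let $n\ge 0$, let $B$ be a connected (in particular nonempty) space, let $Y$ be a space homotopy equivalent to $\Sigma B$ (for instance $Y=\Sigma B$), and let $S^{2n+1}\to X\to Y$ be a homotopy fibration. Then $$\mathsf{TC}[X\to Y]\le 2 .$$ If $X\to Y$ is moreover a fibration, then the bound $\mathsf{TC}[X\to Y]\le 2$ also holds for the direct definition through $\Pi$. -/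

import Mathlib

open scoped unitInterval

namespace ParamTC

universe u v w

/-- The relation generating the unreduced suspension: collapse `B × {0}` to a point and
`B × {1}` to another point. -/
def suspensionRel (B : Type u) (x y : B × I) : Prop :=
  (x.2 = 0 ∧ y.2 = 0) ∨ (x.2 = 1 ∧ y.2 = 1)

/-- The unreduced suspension of `B` (used for nonempty `B`), with the quotient topology. -/
def Suspension (B : Type u) : Type u := Quot (suspensionRel B)

instance (B : Type u) [TopologicalSpace B] : TopologicalSpace (Suspension B) :=
  inferInstanceAs (TopologicalSpace (Quot (suspensionRel B)))

/-- The unit sphere of dimension `d`. -/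
abbrev Sphere (d : ℕ) : Type := Metric.sphere (0 : EuclideanSpace ℝ (Fin (d + 1))) 1

section

variable {X : Type u} {Y : Type v} {F : Type w}
  [TopologicalSpace X] [TopologicalSpace Y] [TopologicalSpace F]

/-- The homotopy fiber of `p` over `y`: points of `X` with a path in `Y` from their image to `y`. -/
abbrev HomotopyFiber (p : C(X, Y)) (y : Y) : Type (max u v) :=
  {z : X × C(I, Y) // z.2 0 = p z.1 ∧ z.2 1 = y}

/-- The projection from the homotopy fiber to the total space. -/
def HomotopyFiber.proj (p : C(X, Y)) (y : Y) : C(HomotopyFiber p y, X) where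
  toFun z := z.1.1

/-- `F → X → Y` is a homotopy fibration: for some base point `y`, the space `F` is homotopy
equivalent to the homotopy fiber of `p` over `y`, compatibly, up to homotopy, with the maps
to `X`. -/
def IsHomotopyFibration (j : C(F, X)) (p : C(X, Y)) : Prop :=
  ∃ (y : Y) (e : ContinuousMap.HomotopyEquiv F (HomotopyFiber p y)),
    ((HomotopyFiber.proj p y).comp e.toFun).Homotopic j

/-- Hurewicz fibration: the homotopy lifting property for all spaces `A`. -/
def IsHurewiczFibration (p : C(X, Y)) : Prop :=
  ∀ (A : Type (max u v)) [TopologicalSpace A] (H : C(A × I, Y)) (f : C(A, X)),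
    (∀ a, p (f a) = H (a, 0)) →
      ∃ G : C(A × I, X), (∀ a, G (a, 0) = f a) ∧ ∀ z, p (G z) = H z

/-- The sectional category of `f` is the least `k` such that the target is covered by `k + 1` open
sets over each of which `f` has a right homotopy inverse (`⊤` if there is no such `k`). -/
noncomputable def secat (f : C(X, Y)) : ℕ∞ :=
  ⨅ (k : ℕ) (_ : ∃ U : Fin (k + 1) → TopologicalSpace.Opens Y, (∀ y, ∃ i, y ∈ U i) ∧
    ∀ i, ∃ s : C(U i, X), (f.comp s).Homotopic ⟨Subtype.val, continuous_subtype_val⟩), (k : ℕ∞)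

/-- The fiberwise product `X ×_Y X`. -/
abbrev FiberProduct (p : C(X, Y)) : Type u := {z : X × X // p z.1 = p z.2}

/-- The fiberwise path space: paths in `X` that stay in a single fiber of `p`. -/
abbrev FiberPathSpace (p : C(X, Y)) : Type u := {γ : C(I, X) // ∃ y, ∀ t, p (γ t) = y}

/-- The endpoint map `γ ↦ (γ 0, γ 1)` from the fiberwise path space to the fiberwise product. -/
def endpointMap (p : C(X, Y)) : C(FiberPathSpace p, FiberProduct p) where
  toFun γ := ⟨(γ.1 0, γ.1 1), by obtain ⟨y, hy⟩ := γ.2; simp [hy]⟩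
  continuous_toFun := by
    refine Continuous.subtype_mk (Continuous.prodMk ?_ ?_) _
    · exact (continuous_eval_const (0 : I)).comp continuous_subtype_val
    · exact (continuous_eval_const (1 : I)).comp continuous_subtype_val

/-- The parametrized topological complexity of a fibration `p`: the least `k` such that
`X ×_Y X` is covered by `k + 1` open sets over each of which the endpoint map has a (strict)
continuous section (`⊤` if there is no such `k`). -/
noncomputable def fibrationTC (p : C(X, Y)) : ℕ∞ :=
  ⨅ (k : ℕ) (_ : ∃ U : Fin (k + 1) → TopologicalSpace.Opens (FiberProduct p),
    (∀ z, ∃ i, z ∈ U i) ∧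
    ∀ i, ∃ s : C(U i, FiberPathSpace p), ∀ z, endpointMap p (s z) = z), (k : ℕ∞)

/-- The homotopy fiber product of `p` with itself: pairs of points of `X` with a path in `Y`
joining their images. -/
abbrev HomotopyFiberProduct (p : C(X, Y)) : Type (max u v) :=
  {z : X × C(I, Y) × X // z.2.1 0 = p z.1 ∧ z.2.1 1 = p z.2.2}

/-- The diagonal map of `X` into the homotopy fiber product, `x ↦ (x, constant path, x)`. -/
def homotopyDiagonal (p : C(X, Y)) : C(X, HomotopyFiberProduct p) where
  toFun x := ⟨(x, ContinuousMap.const I (p x), x), by simp⟩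
  continuous_toFun := by
    refine Continuous.subtype_mk (Continuous.prodMk continuous_id
      (Continuous.prodMk ?_ continuous_id)) _
    exact ContinuousMap.continuous_const'.comp p.continuous

/-- The parametrized topological complexity of an arbitrary map: the sectional category of the
diagonal into the homotopy fiber product. For a fibration the homotopy fiber product is equivalent
to the fiberwise product. -/
noncomputable def mapTC (p : C(X, Y)) : ℕ∞ := secat (homotopyDiagonal p)

end

end ParamTC

/-!
Replace `p : X → Y` by the fibration `q = endMap p` on its mapping path space `Z`. It is enough to cover
the fiberwise product `Z ×_Y Z` by three open sets on each of which the two projections to `Z` are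
fiberwise homotopic: such a homotopy is a right homotopy inverse of the diagonal of `p`, and a strict
section of the endpoint map if `p` is a fibration, because `p` is then a fiberwise homotopy retract
of `q`.

The suspension is the union of two open cones, so that `Y` is the union of two open sets with
null-homotopic inclusions. Over each of them `q` is a fiberwise homotopy retract of a product with the
sphere (`nonempty_fiberChart`), which gives every point of `Z` there a fiber coordinate. On a sphere of
odd dimension two points `x ≠ x'` are joined by a path that depends continuously on them: go from `x`
to `-x'` on a great circle and rotate `-x'` to `x'`. Hence for each chart the open set of pairs with
different coordinates is suitable. What remains is the set of pairs with equal coordinates, and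
the point is that one further open set `D` is enough for both charts. Near such pairs one uses great
circle arcs between the coordinates. On the overlap of the charts the second coordinate is first deformed
until it is a function of the first one, so that equality of the first coordinates implies
that of the second ones; the arcs of the first chart are then carried by the transition function
to short paths, which are interpolated linearly (and projected back to the sphere) to the arcs of
the second chart. The set `D` consists of the pairs for which all segments involved miss the
origin; it is open since the segments are compact (`fiberwiseHomotopic_of_segments`,
`exists_cover_of_charts`).

The overlap is parametrized by a function `τ` on `Y`, with charts over `τ < 5` and over `0 < τ`.
-/

open scoped unitInterval

namespace ParamTC

/-! ### Fiberwise homotopies -/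

section Fiberwise

variable {Y Z Z' V W : Type*} [TopologicalSpace Y] [TopologicalSpace Z] [TopologicalSpace Z']
  [TopologicalSpace V] [TopologicalSpace W]

/-- Two maps `f g : W → Z` with the same projection to `Y` are fiberwise homotopic if they are
joined by a homotopy through maps with that projection. -/
def FiberwiseHomotopic (q : C(Z, Y)) (f g : C(W, Z)) : Prop :=
  ContinuousMap.HomotopicWith f g fun k => ∀ w, q (k w) = q (f w)

namespace FiberwiseHomotopic

variable {q : C(Z, Y)} {f g h : C(W, Z)}

theorem mk (H : I × W → Z) (hc : Continuous H) (h0 : ∀ w, H (0, w) = f w)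
    (h1 : ∀ w, H (1, w) = g w) (hq : ∀ t w, q (H (t, w)) = q (f w)) :
    FiberwiseHomotopic q f g :=
  ⟨{ toFun := H, continuous_toFun := hc, map_zero_left := h0, map_one_left := h1, prop' := hq }⟩

theorem exists_homotopy (H : FiberwiseHomotopic q f g) :
    ∃ K : C(I × W, Z), (∀ w, K (0, w) = f w) ∧ (∀ w, K (1, w) = g w) ∧
      ∀ t w, q (K (t, w)) = q (f w) := by
  obtain ⟨K⟩ := H
  exact ⟨K.toContinuousMap, K.apply_zero, K.apply_one, fun t w => K.prop t w⟩

theorem proj_eq (H : FiberwiseHomotopic q f g) (w : W) : q (g w) = q (f w) := by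
  obtain ⟨K, -, h1, hq⟩ := H.exists_homotopy
  rw [← h1, hq]

theorem symm (H : FiberwiseHomotopic q f g) : FiberwiseHomotopic q g f := by
  have : (fun k : C(W, Z) => ∀ w, q (k w) = q (g w)) = fun k => ∀ w, q (k w) = q (f w) := by
    funext k; simp only [H.proj_eq]
  unfold FiberwiseHomotopic
  rw [this]
  exact ContinuousMap.HomotopicWith.symm H

theorem trans (H : FiberwiseHomotopic q f g) (K : FiberwiseHomotopic q g h) :
    FiberwiseHomotopic q f h := by
  have : (fun k : C(W, Z) => ∀ w, q (k w) = q (g w)) = fun k => ∀ w, q (k w) = q (f w) := by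
    funext k; simp only [H.proj_eq]
  unfold FiberwiseHomotopic at K
  rw [this] at K
  exact ContinuousMap.HomotopicWith.trans H K

theorem precomp (H : FiberwiseHomotopic q f g) (r : C(V, W)) :
    FiberwiseHomotopic q (f.comp r) (g.comp r) := by
  obtain ⟨K, h0, h1, hq⟩ := H.exists_homotopy
  exact .mk (fun z => K (z.1, r z.2)) (by fun_prop) (fun _ => h0 _) (fun _ => h1 _)
    fun _ _ => hq _ _

theorem postcomp (H : FiberwiseHomotopic q f g) {q' : C(Z', Y)} (r : C(Z, Z'))
    (hr : ∀ z, q' (r z) = q z) : FiberwiseHomotopic q' (r.comp f) (r.comp g) := by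
  obtain ⟨K, h0, h1, hq⟩ := H.exists_homotopy
  refine .mk (fun z => r (K z)) (by fun_prop) (fun w => by simp [h0]) (fun w => by simp [h1])
    fun t w => by simp [hr, hq]

end FiberwiseHomotopic

end Fiberwise

/-! ### Spheres -/

section SphereLemmas

variable {d : ℕ}

instance : Nonempty (Sphere d) :=
  (NormedSpace.sphere_nonempty (E := EuclideanSpace ℝ (Fin (d + 1)))).2 zero_le_one |>.to_subtype

open Classical in
/-- Radial projection to the unit sphere, with an arbitrary value at the origin. -/
noncomputable def radial (v : EuclideanSpace ℝ (Fin (d + 1))) : Sphere d :=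
  if h : v = 0 then Classical.arbitrary _ else ⟨‖v‖⁻¹ • v, by simp [norm_smul, h]⟩

theorem radial_coe (x : Sphere d) : radial (x : EuclideanSpace ℝ (Fin (d + 1))) = x := by
  have h1 : ‖(x : EuclideanSpace ℝ (Fin (d + 1)))‖ = 1 := by simp
  have h : (x : EuclideanSpace ℝ (Fin (d + 1))) ≠ 0 := fun h => by simp [h] at h1
  ext1
  simp [radial, h, h1]

theorem continuousOn_radial :
    ContinuousOn (radial : EuclideanSpace ℝ (Fin (d + 1)) → Sphere d) {v | v ≠ 0} := by
  rw [Topology.IsInducing.subtypeVal.continuousOn_iff]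
  have : ContinuousOn (fun v : EuclideanSpace ℝ (Fin (d + 1)) => ‖v‖⁻¹ • v) {v | v ≠ 0} :=
    (continuousOn_id.norm.inv₀ fun v hv => by simpa using hv).smul continuousOn_id
  refine this.congr fun v hv => ?_
  have hv' : v ≠ 0 := hv
  simp [radial, hv']

/-- The point at time `t` of the straight segment from `x` to `y` in the ambient space. -/
def seg (x y : Sphere d) (t : I) : EuclideanSpace ℝ (Fin (d + 1)) :=
  (1 - (t : ℝ)) • (x : EuclideanSpace ℝ (Fin (d + 1))) +
    (t : ℝ) • (y : EuclideanSpace ℝ (Fin (d + 1)))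

@[simp] theorem seg_zero (x y : Sphere d) : seg x y 0 = x := by simp [seg]

@[simp] theorem seg_one (x y : Sphere d) : seg x y 1 = y := by simp [seg]

@[simp] theorem seg_self (x : Sphere d) (t : I) : seg x x t = x := by
  simp [seg, ← add_smul]

@[fun_prop]
theorem continuous_seg : Continuous fun z : Sphere d × Sphere d × I => seg z.1 z.2.1 z.2.2 := by
  unfold seg; fun_prop

theorem coe_ne_zero (x : Sphere d) : (x : EuclideanSpace ℝ (Fin (d + 1))) ≠ 0 :=
  ne_zero_of_mem_unit_sphere x

theorem seg_ne_zero {x y : Sphere d} (h : x ≠ -y) (t : I) : seg x y t ≠ 0 := by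
  intro h0
  have hx : ‖(x : EuclideanSpace ℝ (Fin (d + 1)))‖ = 1 := by simp
  have hy : ‖(y : EuclideanSpace ℝ (Fin (d + 1)))‖ = 1 := by simp
  have h1 : (1 - (t : ℝ)) • (x : EuclideanSpace ℝ (Fin (d + 1))) = -((t : ℝ) • (y : EuclideanSpace ℝ (Fin (d + 1)))) :=
    eq_neg_of_add_eq_zero_left h0
  have h2 := congrArg norm h1
  rw [norm_neg, norm_smul, norm_smul, hx, hy, Real.norm_of_nonneg (by linarith [t.2.2]),
    Real.norm_of_nonneg t.2.1, mul_one, mul_one] at h2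
  apply h
  ext1
  have h3 : (t : ℝ) ≠ 0 := by intro h3; rw [h3] at h2; norm_num at h2
  rw [h2, ← smul_neg] at h1
  simpa using smul_right_injective _ h3 h1

/-- Maps to a sphere that are nowhere antipodal are homotopic along great circle arcs. -/
theorem homotopic_of_ne_neg {W : Type*} [TopologicalSpace W] {f g : C(W, Sphere d)}
    (h : ∀ w, f w ≠ -g w) : f.Homotopic g := by
  refine ⟨⟨⟨fun z => radial (seg (f z.2) (g z.2) z.1), ?_⟩, fun w => ?_, fun w => ?_⟩⟩
  · exact continuousOn_radial.comp_continuous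
      (continuous_seg.comp (f := fun z : I × W => (f z.2, g z.2, z.1)) (by fun_prop))
      fun z => seg_ne_zero (h z.2) z.1
  · simp [radial_coe]
  · simp [radial_coe]

/-- An even-dimensional Euclidean space is isometric to a complex one. -/
theorem nonempty_isometry_complex (n : ℕ) :
    Nonempty (EuclideanSpace ℝ (Fin (2 * n + 1 + 1)) ≃ₗᵢ[ℝ] PiLp 2 fun _ : Fin (n + 1) => ℂ) := by
  have hfr : Module.finrank ℝ (EuclideanSpace ℝ (Fin (2 * n + 1 + 1))) =
      Module.finrank ℝ (PiLp 2 fun _ : Fin (n + 1) => ℂ) := by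
    rw [finrank_euclideanSpace_fin, (WithLp.linearEquiv 2 ℝ (Fin (n + 1) → ℂ)).finrank_eq,
      Module.finrank_pi_fintype]
    simp [Complex.finrank_real_complex]; ring
  exact ⟨(stdOrthonormalBasis ℝ _).equiv (stdOrthonormalBasis ℝ _) (finCongr hfr)⟩

/-- The antipodal map of an odd-dimensional sphere is homotopic to the identity: view the ambient
space as `ℂ ^ (n + 1)` and multiply by the unit complex numbers of the upper half circle. -/
theorem neg_homotopic_id (n : ℕ) :
    (⟨fun x => -x, continuous_neg⟩ : C(Sphere (2 * n + 1), Sphere (2 * n + 1))).Homotopic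
      (ContinuousMap.id _) := by
  obtain ⟨e⟩ := nonempty_isometry_complex n
  let c : I → ℂ := fun t => Complex.exp ((Real.pi * (t : ℝ) : ℝ) * Complex.I)
  have hc : Continuous c := by fun_prop
  have hn : ∀ t, ‖c t‖ = 1 := fun t => Complex.norm_exp_ofReal_mul_I _
  have hc0 : c 0 = 1 := by simp [c]
  have hc1 : c 1 = -1 := by simp [c]
  have hmem : ∀ z : I × Sphere (2 * n + 1), e.symm (c z.1 • e z.2) ∈
      Metric.sphere (0 : EuclideanSpace ℝ (Fin (2 * n + 1 + 1))) 1 := fun z => by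
    have hz : ‖(z.2 : EuclideanSpace ℝ (Fin (2 * n + 1 + 1)))‖ = 1 := norm_eq_of_mem_sphere z.2
    rw [mem_sphere_zero_iff_norm, LinearIsometryEquiv.norm_map, norm_smul, hn, one_mul,
      LinearIsometryEquiv.norm_map, hz]
  have hcont : Continuous fun z : I × Sphere (2 * n + 1) => e.symm (c z.1 • e z.2) :=
    e.symm.continuous.comp ((hc.comp continuous_fst).smul
      (e.continuous.comp (continuous_subtype_val.comp continuous_snd)))
  refine ContinuousMap.Homotopic.symm
    ⟨⟨⟨fun z => ⟨_, hmem z⟩, hcont.subtype_mk hmem⟩, fun x => ?_, fun x => ?_⟩⟩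
  · apply Subtype.ext
    change e.symm (c 0 • e x) = x
    rw [hc0, one_smul, e.symm_apply_apply]
  · apply Subtype.ext
    change e.symm (c 1 • e x) = -(x : EuclideanSpace ℝ (Fin (2 * n + 1 + 1)))
    rw [hc1, neg_one_smul, map_neg, e.symm_apply_apply]

/-- On an odd-dimensional sphere two maps without coincidences are homotopic: the first is
nowhere antipodal to the negative of the second. -/
theorem homotopic_of_ne {n : ℕ} {W : Type*} [TopologicalSpace W] {f g : C(W, Sphere (2 * n + 1))}
    (h : ∀ w, f w ≠ g w) : f.Homotopic g := by
  let ng : C(W, Sphere (2 * n + 1)) := (⟨fun x => -x, continuous_neg⟩ : C(_, _)).comp g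
  have h1 : f.Homotopic ng := homotopic_of_ne_neg fun w => by
    simpa [ng] using h w
  exact h1.trans ((neg_homotopic_id n).comp (.refl g))

end SphereLemmas

/-! ### Charts for a map over an open set -/

section Charts

variable {Y Z F W : Type*} [TopologicalSpace Y] [TopologicalSpace Z] [TopologicalSpace F]
  [TopologicalSpace W]

/-- A chart exhibits the part of `q : Z → Y` over `A` as a fiberwise homotopy retract of the product
`A × F`. All maps are total functions, which are meaningful over `A` only; the deformation
from `z` to `ofFiber (q z, toFiber z)` starts at `z` and is vertical everywhere, but its end is only
specified over `A`. -/
structure FiberChart (q : C(Z, Y)) (A : Set Y) (F : Type*) [TopologicalSpace F] where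
  /-- The fiber coordinate. -/
  toFiber : Z → F
  /-- The parametrization of the fibers. -/
  ofFiber : Y × F → Z
  /-- The vertical deformation from the identity to the composite of the other two maps. -/
  deform : I × Z → Z
  continuousOn_toFiber : ContinuousOn toFiber (q ⁻¹' A)
  continuousOn_ofFiber : ContinuousOn ofFiber (A ×ˢ Set.univ)
  continuousOn_deform : ContinuousOn deform (Set.univ ×ˢ (q ⁻¹' A))
  proj_ofFiber : ∀ y ∈ A, ∀ x, q (ofFiber (y, x)) = y
  proj_deform : ∀ t z, q (deform (t, z)) = q z
  deform_zero : ∀ z, deform (0, z) = z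
  deform_one : ∀ z, q z ∈ A → deform (1, z) = ofFiber (q z, toFiber z)

namespace FiberChart

variable {q : C(Z, Y)} {A : Set Y} (c : FiberChart q A F)

/-- Maps over `A` whose fiber coordinates are homotopic are fiberwise homotopic. -/
theorem fiberwiseHomotopic {f g : C(W, Z)} (hf : ∀ w, q (f w) ∈ A) (hfg : ∀ w, q (g w) = q (f w))
    {x y : C(W, F)} (hx : ∀ w, x w = c.toFiber (f w)) (hy : ∀ w, y w = c.toFiber (g w))
    (H : x.Homotopic y) : FiberwiseHomotopic q f g := by
  have hof : ∀ {V : Type _} [TopologicalSpace V] (u : C(V, W)) (k : C(V, F)),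
      Continuous fun v => c.ofFiber (q (f (u v)), k v) := fun u k =>
    c.continuousOn_ofFiber.comp_continuous (by fun_prop) fun v => ⟨hf _, trivial⟩
  have key : ∀ (g' : C(W, Z)) (k : C(W, F)), (∀ w, q (g' w) = q (f w)) →
      (∀ w, k w = c.toFiber (g' w)) →
      FiberwiseHomotopic q g' ⟨fun w => c.ofFiber (q (f w), k w), hof (.id _) k⟩ := by
    intro g' k hg hk
    refine .mk (fun z => c.deform (z.1, g' z.2)) ?_ (fun w => c.deform_zero _) (fun w => ?_)
      fun t w => c.proj_deform _ _
    · exact c.continuousOn_deform.comp_continuous (by fun_prop) fun z => ⟨trivial, by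
        simpa [hg] using hf z.2⟩
    · simp [c.deform_one (g' w) (by simpa [hg] using hf w), hg, hk]
  refine (key f x (fun _ => rfl) hx).trans (.trans ?_ (key g y hfg hy).symm)
  obtain ⟨K⟩ := H
  refine .mk (fun z => c.ofFiber (q (f z.2), K z)) (hof ⟨Prod.snd, continuous_snd⟩ K.toContinuousMap)
    (fun w => by simp; rfl) (fun w => by simp; rfl) fun t w => ?_
  exact (c.proj_ofFiber _ (hf w) _).trans (c.proj_ofFiber _ (hf w) _).symm

/-- A deformation over `A` slowed down by a function vanishing outside a smaller set is continuous
on the whole space. -/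
theorem continuous_deform_mul (hA : IsOpen A) {O : Set Y} (hO : IsOpen O) (hAO : A ∪ O = Set.univ)
    {ρ : C(Y, I)} (hρ : ∀ y ∈ O, ρ y = 0) :
    Continuous fun z : I × Z => c.deform (z.1 * ρ (q z.2), z.2) := by
  rw [continuous_iff_continuousAt]
  intro z
  rcases (hAO.symm ▸ Set.mem_univ (q z.2) : q z.2 ∈ A ∪ O) with h | h
  · have h1 : ContinuousAt c.deform (z.1 * ρ (q z.2), z.2) :=
      c.continuousOn_deform.continuousAt
        ((isOpen_univ.prod (hA.preimage q.continuous)).mem_nhds ⟨trivial, h⟩)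
    exact h1.comp (f := fun z : I × Z => (z.1 * ρ (q z.2), z.2)) (by fun_prop)
  · have h1 : ∀ᶠ z' in nhds z, z'.2 = c.deform (z'.1 * ρ (q z'.2), z'.2) := by
      have : ∀ᶠ z' : I × Z in nhds z, q z'.2 ∈ O :=
        (by fun_prop : Continuous fun z' : I × Z => q z'.2).continuousAt.eventually_mem
          (hO.mem_nhds h)
      filter_upwards [this] with z' hz'
      simp [hρ _ hz', c.deform_zero]
    exact continuousAt_snd.congr h1

/-- The end map of the deformation slowed down by `ρ`. -/
noncomputable def partialDeform (hA : IsOpen A) {O : Set Y} (hO : IsOpen O)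
    (hAO : A ∪ O = Set.univ) {ρ : C(Y, I)} (hρ : ∀ y ∈ O, ρ y = 0) : C(Z, Z) where
  toFun z := c.deform (ρ (q z), z)
  continuous_toFun := by
    have := (c.continuous_deform_mul hA hO hAO hρ).comp
      (f := fun z : Z => ((1 : I), z)) (by fun_prop)
    simpa [Function.comp_def] using this

theorem fiberwiseHomotopic_partialDeform (hA : IsOpen A) {O : Set Y} (hO : IsOpen O)
    (hAO : A ∪ O = Set.univ) {ρ : C(Y, I)} (hρ : ∀ y ∈ O, ρ y = 0) :
    FiberwiseHomotopic q (.id Z) (c.partialDeform hA hO hAO hρ) :=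
  .mk _ (c.continuous_deform_mul hA hO hAO hρ) (fun z => by simp [c.deform_zero])
    (fun z => by simp [partialDeform]) fun t z => c.proj_deform _ _

end FiberChart

end Charts

/-! ### Three open sets from two charts -/

/-- By the tube lemma, a family of open conditions parametrized by a compact space is open. -/
theorem isOpen_inter_setOf_forall_ne {W K E : Type*} [TopologicalSpace W] [TopologicalSpace K]
    [CompactSpace K] [TopologicalSpace E] [T1Space E] {O : Set W} (hO : IsOpen O) {v : W × K → E}
    (hv : ContinuousOn v (O ×ˢ Set.univ)) (e : E) : IsOpen (O ∩ {w | ∀ k, v (w, k) ≠ e}) := by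
  rw [isOpen_iff_mem_nhds]
  rintro w ⟨hw, hk⟩
  refine Filter.inter_mem (hO.mem_nhds hw) ?_
  have := isCompact_univ.eventually_forall_of_forall_eventually (x₀ := w) (K := Set.univ)
    (P := fun w k => v (w, k) ≠ e) fun k _ => by
      have hc : ContinuousAt v (w, k) :=
        hv.continuousAt ((hO.prod isOpen_univ).mem_nhds ⟨hw, trivial⟩)
      exact hc.eventually_ne (hk k)
  filter_upwards [this] with w' hw' k using hw' k trivial

/-- The ramp that is `0` up to `a` and `1` from `a + 1` on. -/
noncomputable def ramp (a : ℝ) : C(ℝ, I) where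
  toFun x := Set.projIcc 0 1 zero_le_one (x - a)
  continuous_toFun := continuous_projIcc.comp (by fun_prop)

theorem ramp_of_le {a x : ℝ} (h : x ≤ a) : ramp a x = 0 :=
  Set.projIcc_of_le_left zero_le_one (by linarith)

theorem ramp_of_ge {a x : ℝ} (h : a + 1 ≤ x) : ramp a x = 1 :=
  Set.projIcc_of_right_le zero_le_one (by linarith)

section Cover

variable {Y Z W : Type*} [TopologicalSpace Y] [TopologicalSpace Z] [TopologicalSpace W]

namespace FiberChart

variable {d : ℕ} {q : C(Z, Y)} {A₀ A₁ : Set Y} (c₀ : FiberChart q A₀ (Sphere d))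
  (c₁ : FiberChart q A₁ (Sphere d))

/-- The change of fiber coordinates between two charts. -/
def transition (z : Y × Sphere d) : Sphere d := c₁.toFiber (c₀.ofFiber z)

theorem continuousOn_transition :
    ContinuousOn (transition c₀ c₁) ((A₀ ∩ A₁) ×ˢ Set.univ) := by
  refine c₁.continuousOn_toFiber.comp (c₀.continuousOn_ofFiber.mono
    (Set.prod_mono Set.inter_subset_left subset_rfl)) ?_
  rintro ⟨y, x⟩ ⟨hy, -⟩
  simpa [c₀.proj_ofFiber y hy.1] using hy.2

/-- At time `k` of the deformation and for fiber coordinates `x`, `x'` over `y`, the path that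
interpolates linearly between the image under the transition of the arc from `x` to `x'` and the
segment joining the images of `x` and `x'`. -/
noncomputable def mixedPath (y : Y) (x x' : Sphere d) (k s : I) :
    EuclideanSpace ℝ (Fin (d + 1)) :=
  (1 - (k : ℝ)) • (transition c₀ c₁ (y, radial (seg x x' s)) : EuclideanSpace ℝ (Fin (d + 1))) +
    (k : ℝ) • seg (transition c₀ c₁ (y, x)) (transition c₀ c₁ (y, x')) s

theorem mixedPath_zero_right (y : Y) (x x' : Sphere d) (k : I) :
    mixedPath c₀ c₁ y x x' k 0 = transition c₀ c₁ (y, x) := by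
  simp [mixedPath, radial_coe, ← add_smul]

theorem mixedPath_one_right (y : Y) (x x' : Sphere d) (k : I) :
    mixedPath c₀ c₁ y x x' k 1 = transition c₀ c₁ (y, x') := by
  simp [mixedPath, radial_coe, ← add_smul]

theorem mixedPath_self (y : Y) (x : Sphere d) (k s : I) :
    mixedPath c₀ c₁ y x x k s = transition c₀ c₁ (y, x) := by
  simp [mixedPath, radial_coe, ← add_smul]

theorem continuousOn_mixedPath : ContinuousOn
    (fun z : Y × Sphere d × Sphere d × I × I =>
      mixedPath c₀ c₁ z.1 z.2.1 z.2.2.1 z.2.2.2.1 z.2.2.2.2)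
    {z | z.1 ∈ A₀ ∩ A₁ ∧ seg z.2.1 z.2.2.1 z.2.2.2.2 ≠ 0} := by
  have hr : ContinuousOn (fun z : Y × Sphere d × Sphere d × I × I =>
      radial (seg z.2.1 z.2.2.1 z.2.2.2.2))
      {z | z.1 ∈ A₀ ∩ A₁ ∧ seg z.2.1 z.2.2.1 z.2.2.2.2 ≠ 0} :=
    continuousOn_radial.comp (continuous_seg.comp (f := fun z : Y × Sphere d × Sphere d × I × I =>
      (z.2.1, z.2.2.1, z.2.2.2.2)) (by fun_prop)).continuousOn fun z hz => hz.2
  have ht : ∀ {x : Y × Sphere d × Sphere d × I × I → Sphere d},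
      ContinuousOn x {z | z.1 ∈ A₀ ∩ A₁ ∧ seg z.2.1 z.2.2.1 z.2.2.2.2 ≠ 0} →
      ContinuousOn (fun z => transition c₀ c₁ (z.1, x z))
        {z | z.1 ∈ A₀ ∩ A₁ ∧ seg z.2.1 z.2.2.1 z.2.2.2.2 ≠ 0} := fun hx =>
    (continuousOn_transition c₀ c₁).comp (continuousOn_fst.prodMk hx) fun z hz => ⟨hz.1, trivial⟩
  have h1 := ht hr
  have h2 := ht (x := fun z => z.2.1) (by fun_prop)
  have h3 := ht (x := fun z => z.2.2.1) (by fun_prop)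
  have h4 := continuous_seg.comp_continuousOn (h2.prodMk (h3.prodMk
    (continuousOn_snd.snd.snd.snd : ContinuousOn
      (fun z : Y × Sphere d × Sphere d × I × I => z.2.2.2.2) _)))
  have hk : Continuous fun z : Y × Sphere d × Sphere d × I × I => (z.2.2.2.1 : ℝ) := by fun_prop
  exact ((continuous_const.sub hk).continuousOn.smul
    (continuous_subtype_val.comp_continuousOn h1)).add (hk.continuousOn.smul h4)

end FiberChart

open FiberChart

/-- The motion planner near the diagonal: `f` and `g` are fiberwise homotopic, after the
deformations `θ₀` and `θ₁`, by the arcs seen in the first chart where `τ ≤ 2`, by the arcs seen in the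
second chart where `3 ≤ τ`, and by an interpolation between. -/
theorem fiberwiseHomotopic_of_segments {d : ℕ} {q : C(Z, Y)} {τ : C(Y, ℝ)}
    (c₀ : FiberChart q {y | τ y < 5} (Sphere d)) (c₁ : FiberChart q {y | 0 < τ y} (Sphere d))
    {θ₀ θ₁ : C(Z, Z)} (hθ₀ : ∀ z, τ (q z) ≤ 3 → θ₀ z = c₀.deform (1, z))
    (hθ₁ : ∀ z, 2 ≤ τ (q z) → θ₁ z = c₁.deform (1, z))
    (hq₀ : ∀ z, q (θ₀ z) = q z) (hq₁ : ∀ z, q (θ₁ z) = q z)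
    {f g : C(W, Z)} (hfg : ∀ w, q (g w) = q (f w))
    (h₀ : ∀ w, τ (q (f w)) ≤ 3 → ∀ s, seg (c₀.toFiber (f w)) (c₀.toFiber (g w)) s ≠ 0)
    (hm : ∀ w, 2 ≤ τ (q (f w)) → τ (q (f w)) ≤ 3 → ∀ k s,
      mixedPath c₀ c₁ (q (f w)) (c₀.toFiber (f w)) (c₀.toFiber (g w)) k s ≠ 0)
    (h₁ : ∀ w, 3 ≤ τ (q (f w)) →
      ∀ s, seg (c₁.toFiber (θ₀ (f w))) (c₁.toFiber (θ₀ (g w))) s ≠ 0) :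
    FiberwiseHomotopic q (θ₁.comp (θ₀.comp f)) (θ₁.comp (θ₀.comp g)) := by
  have hθ₀' : ∀ z, τ (q z) ≤ 3 → θ₀ z = c₀.ofFiber (q z, c₀.toFiber z) := fun z hz => by
    rw [hθ₀ z hz, c₀.deform_one z (show τ (q z) < 5 by linarith)]
  have hθ₁' : ∀ z, 2 ≤ τ (q z) → θ₁ z = c₁.ofFiber (q z, c₁.toFiber z) := fun z hz => by
    rw [hθ₁ z hz, c₁.deform_one z (show 0 < τ (q z) by linarith)]
  have hof : ∀ (y : Y) (x : Sphere d), 2 ≤ τ y → τ y ≤ 3 →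
      θ₁ (c₀.ofFiber (y, x)) = c₁.ofFiber (y, transition c₀ c₁ (y, x)) := fun y x hy hy' => by
    have := c₀.proj_ofFiber y (show τ y < 5 by linarith) x
    rw [hθ₁' _ (by rwa [this]), this]; rfl
  -- `A`, `B`, `C` are the paths for `τ ≤ 2`, for `2 ≤ τ ≤ 3`, where the ramp runs through the
  -- interpolation, and for `3 ≤ τ`.
  let A : I × W → Z := fun z =>
    θ₁ (c₀.ofFiber (q (f z.2), radial (seg (c₀.toFiber (f z.2)) (c₀.toFiber (g z.2)) z.1)))
  let B : I × W → Z := fun z => c₁.ofFiber (q (f z.2), radial (mixedPath c₀ c₁ (q (f z.2))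
    (c₀.toFiber (f z.2)) (c₀.toFiber (g z.2)) (ramp 2 (τ (q (f z.2)))) z.1))
  let C : I × W → Z := fun z => c₁.ofFiber (q (f z.2),
    radial (seg (c₁.toFiber (θ₀ (f z.2))) (c₁.toFiber (θ₀ (g z.2))) z.1))
  let M : I × W → Z := fun z =>
    if τ (q (f z.2)) ≤ 2 then A z else if τ (q (f z.2)) ≤ 3 then B z else C z
  have hMA : ∀ z : I × W, τ (q (f z.2)) ≤ 2 → M z = A z := fun z hz => if_pos hz
  have hMB : ∀ z : I × W, 2 ≤ τ (q (f z.2)) → τ (q (f z.2)) ≤ 3 → M z = B z := by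
    intro z hz hz'
    rcases hz.eq_or_lt with h | h
    · rw [hMA z h.ge]
      simp only [A, B]
      rw [hof _ _ hz hz', ramp_of_le h.ge]
      simp [mixedPath, radial_coe]
    · simp only [M, if_neg h.not_ge, if_pos hz']
  have hMC : ∀ z : I × W, 3 ≤ τ (q (f z.2)) → M z = C z := by
    intro z hz
    rcases hz.eq_or_lt with h | h
    · rw [hMB z (by linarith) h.ge]
      simp only [B, C]
      rw [ramp_of_ge (by linarith), hθ₀' _ h.ge, hθ₀' _ (by rw [hfg]; exact h.ge), hfg]
      simp [mixedPath, transition]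
    · simp only [M, if_neg h.not_ge, if_neg (show ¬ τ (q (f z.2)) ≤ 2 by linarith)]
  have ha₀ : ∀ k : C(W, Z), (∀ w, q (k w) = q (f w)) → ContinuousOn
      (fun z : I × W => c₀.toFiber (k z.2)) {z | τ (q (f z.2)) ≤ 3} := fun k hk => by
    refine c₀.continuousOn_toFiber.comp (by fun_prop) fun z hz => ?_
    have hz' : τ (q (f z.2)) ≤ 3 := hz
    change τ (q (k z.2)) < 5
    rw [hk]; linarith
  have ha₁ : ∀ k : C(W, Z), (∀ w, q (k w) = q (f w)) → ContinuousOn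
      (fun z : I × W => c₁.toFiber (θ₀ (k z.2))) {z | 3 ≤ τ (q (f z.2))} := fun k hk => by
    refine c₁.continuousOn_toFiber.comp (by fun_prop) fun z hz => ?_
    have hz' : 3 ≤ τ (q (f z.2)) := hz
    change 0 < τ (q (θ₀ (k z.2)))
    rw [hq₀, hk]; linarith
  have hcA : ContinuousOn A {z | τ (q (f z.2)) ≤ 2} := by
    have hle : {z : I × W | τ (q (f z.2)) ≤ 2} ⊆ {z | τ (q (f z.2)) ≤ 3} := fun z hz => by
      have hz' : τ (q (f z.2)) ≤ 2 := hz
      change τ (q (f z.2)) ≤ 3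
      linarith
    have hs := continuous_seg.comp_continuousOn
      (((ha₀ f fun _ => rfl).mono hle).prodMk (((ha₀ g hfg).mono hle).prodMk continuousOn_fst))
    have hr := continuousOn_radial.comp hs fun z hz => h₀ z.2 (hle hz) z.1
    have hq : ContinuousOn (fun z : I × W => q (f z.2)) {z | τ (q (f z.2)) ≤ 2} := by fun_prop
    refine θ₁.continuous.comp_continuousOn (c₀.continuousOn_ofFiber.comp (hq.prodMk hr)
      fun z hz => ⟨?_, trivial⟩)
    have hz' : τ (q (f z.2)) ≤ 2 := hz
    change τ (q (f z.2)) < 5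
    linarith
  have hcB : ContinuousOn B {z | 2 ≤ τ (q (f z.2)) ∧ τ (q (f z.2)) ≤ 3} := by
    have hle : {z : I × W | 2 ≤ τ (q (f z.2)) ∧ τ (q (f z.2)) ≤ 3} ⊆ {z | τ (q (f z.2)) ≤ 3} :=
      fun z hz => hz.2
    have hq : ContinuousOn (fun z : I × W => q (f z.2))
      {z | 2 ≤ τ (q (f z.2)) ∧ τ (q (f z.2)) ≤ 3} := by fun_prop
    have hk : ContinuousOn (fun z : I × W => ramp 2 (τ (q (f z.2))))
      {z | 2 ≤ τ (q (f z.2)) ∧ τ (q (f z.2)) ≤ 3} := by fun_prop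
    have hpos : ∀ z : I × W, 2 ≤ τ (q (f z.2)) → 0 < τ (q (f z.2)) := fun z hz => by linarith
    have hlt : ∀ z : I × W, τ (q (f z.2)) ≤ 3 → τ (q (f z.2)) < 5 := fun z hz => by linarith
    have hp := hq.prodMk (((ha₀ f fun _ => rfl).mono hle).prodMk
      (((ha₀ g hfg).mono hle).prodMk (hk.prodMk continuousOn_fst)))
    have hmix := (continuousOn_mixedPath c₀ c₁).comp hp
      fun z hz => ⟨⟨hlt z hz.2, hpos z hz.1⟩, h₀ z.2 hz.2 z.1⟩
    have hr := continuousOn_radial.comp hmix fun z hz => hm z.2 hz.1 hz.2 _ _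
    exact c₁.continuousOn_ofFiber.comp (hq.prodMk hr) fun z hz => ⟨hpos z hz.1, trivial⟩
  have hcC : ContinuousOn C {z | 3 ≤ τ (q (f z.2))} := by
    have hs := continuous_seg.comp_continuousOn
      ((ha₁ f fun _ => rfl).prodMk ((ha₁ g hfg).prodMk continuousOn_fst))
    have hr := continuousOn_radial.comp hs fun z hz => h₁ z.2 hz z.1
    have hq : ContinuousOn (fun z : I × W => q (f z.2)) {z | 3 ≤ τ (q (f z.2))} := by fun_prop
    refine c₁.continuousOn_ofFiber.comp (hq.prodMk hr) fun z hz => ⟨?_, trivial⟩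
    have hz' : 3 ≤ τ (q (f z.2)) := hz
    change 0 < τ (q (f z.2))
    linarith
  have hτ : Continuous fun z : I × W => τ (q (f z.2)) := by fun_prop
  refine .mk M ?_ (fun w => ?_) (fun w => ?_) fun t w => ?_
  · have hBC := ContinuousOn.union_of_isClosed (hcB.congr fun z hz => hMB z hz.1 hz.2)
      (hcC.congr hMC) ((isClosed_le continuous_const hτ).inter (isClosed_le hτ continuous_const))
      (isClosed_le continuous_const hτ)
    have hABC := ContinuousOn.union_of_isClosed (hcA.congr hMA) hBC
      (isClosed_le hτ continuous_const)
      (((isClosed_le continuous_const hτ).inter (isClosed_le hτ continuous_const)).union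
        (isClosed_le continuous_const hτ))
    refine continuousOn_univ.1 (hABC.mono fun z _ => ?_)
    rcases le_total (τ (q (f z.2))) 2 with h | h
    · exact Or.inl h
    · exact Or.inr ((le_total (τ (q (f z.2))) 3).imp (fun h' => ⟨h, h'⟩) id)
  · rcases le_total (τ (q (f w))) 2 with h | h
    · rw [hMA _ h]
      simp [A, radial_coe, hθ₀' _ (h.trans (by norm_num : (2 : ℝ) ≤ 3))]
    rcases le_total (τ (q (f w))) 3 with h' | h'
    · rw [hMB _ h h']
      simp [B, mixedPath_zero_right, radial_coe, hθ₀' _ h', hof _ _ h h']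
    · rw [hMC _ h']
      simp [C, radial_coe, hθ₁' (θ₀ (f w)) (by rwa [hq₀]), hq₀]
  · rcases le_total (τ (q (f w))) 2 with h | h
    · rw [hMA _ h]
      simp [A, radial_coe, hθ₀' (g w) (by rw [hfg]; linarith), hfg]
    rcases le_total (τ (q (f w))) 3 with h' | h'
    · rw [hMB _ h h']
      simp [B, mixedPath_one_right, radial_coe, hθ₀' (g w) (by rwa [hfg]), hfg, hof _ _ h h']
    · rw [hMC _ h']
      simp [C, radial_coe, hθ₁' (θ₀ (g w)) (by rwa [hq₀, hfg]), hq₀, hfg]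
  · simp only [ContinuousMap.comp_apply, hq₁, hq₀]
    rcases le_total (τ (q (f w))) 2 with h | h
    · rw [hMA _ h]
      simp only [A, hq₁]
      exact c₀.proj_ofFiber _ (show τ (q (f w)) < 5 by linarith) _
    have hpos : 0 < τ (q (f w)) := by linarith
    rcases le_total (τ (q (f w))) 3 with h' | h'
    · rw [hMB _ h h']; exact c₁.proj_ofFiber _ hpos _
    · rw [hMC _ h']; exact c₁.proj_ofFiber _ hpos _

/-- Two charts with odd spheres as fibers give three open sets over which the two projections of
the fiberwise product are fiberwise homotopic: two sets on which the points have different fiber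
coordinates in one of the charts, and a neighbourhood of the part where they agree. -/
theorem exists_cover_of_charts {n : ℕ} {q : C(Z, Y)} {τ : C(Y, ℝ)}
    (c₀ : FiberChart q {y | τ y < 5} (Sphere (2 * n + 1)))
    (c₁ : FiberChart q {y | 0 < τ y} (Sphere (2 * n + 1))) :
    ∃ U : Fin 3 → TopologicalSpace.Opens (FiberProduct q), (∀ w, ∃ i, w ∈ U i) ∧
      ∀ i, FiberwiseHomotopic q (W := U i) ⟨fun w => w.1.1.1, by fun_prop⟩
        ⟨fun w => w.1.1.2, by fun_prop⟩ := by
  have hA₀ : IsOpen {y | τ y < 5} := isOpen_lt τ.continuous continuous_const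
  have hA₁ : IsOpen {y | 0 < τ y} := isOpen_lt continuous_const τ.continuous
  have hρ₀ : ∀ y ∈ {y | 4 < τ y}, (⟨fun y => σ (ramp 3 (τ y)), by fun_prop⟩ : C(Y, I)) y = 0 :=
    fun y hy => by
      have h : (4 : ℝ) < τ y := hy
      simp [ramp_of_ge (a := 3) (show (3 : ℝ) + 1 ≤ τ y by linarith)]
  have hρ₁ : ∀ y ∈ {y | τ y < 1}, ((ramp 1).comp τ) y = 0 :=
    fun y hy => by
      have h : τ y < 1 := hy
      simp [ramp_of_le h.le]
  have hO₀ : IsOpen {y | 4 < τ y} := isOpen_lt continuous_const τ.continuous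
  have hO₁ : IsOpen {y | τ y < 1} := isOpen_lt τ.continuous continuous_const
  have hAO₀ : {y | τ y < 5} ∪ {y | 4 < τ y} = Set.univ := Set.eq_univ_of_forall fun y => by
    rcases lt_or_ge (τ y) 5 with h | h
    · exact Or.inl h
    · exact Or.inr (lt_of_lt_of_le (by norm_num) h)
  have hAO₁ : {y | 0 < τ y} ∪ {y | τ y < 1} = Set.univ := Set.eq_univ_of_forall fun y => by
    rcases lt_or_ge 0 (τ y) with h | h
    · exact Or.inl h
    · exact Or.inr (lt_of_le_of_lt h (by norm_num))
  -- `θ₀` is the projection to the first chart where `τ ≤ 3` and the identity where `4 ≤ τ`; it deforms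
  -- the coordinate of the second chart into a function of that of the first one. `θ₁` is the
  -- projection to the second chart where `2 ≤ τ` and the identity where `τ ≤ 1`.
  obtain ⟨θ₀, hH₀, hθ₀⟩ : ∃ θ₀ : C(Z, Z), FiberwiseHomotopic q (.id Z) θ₀ ∧
      ∀ z, τ (q z) ≤ 3 → θ₀ z = c₀.deform (1, z) :=
    ⟨c₀.partialDeform hA₀ hO₀ hAO₀ hρ₀, c₀.fiberwiseHomotopic_partialDeform hA₀ hO₀ hAO₀ hρ₀,
      fun z hz => by simp [partialDeform, ramp_of_le hz]⟩
  obtain ⟨θ₁, hH₁, hθ₁⟩ : ∃ θ₁ : C(Z, Z), FiberwiseHomotopic q (.id Z) θ₁ ∧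
      ∀ z, 2 ≤ τ (q z) → θ₁ z = c₁.deform (1, z) :=
    ⟨c₁.partialDeform hA₁ hO₁ hAO₁ hρ₁, c₁.fiberwiseHomotopic_partialDeform hA₁ hO₁ hAO₁ hρ₁,
      fun z hz => by simp [partialDeform, ramp_of_ge (a := 1) (x := τ (q z)) (by linarith)]⟩
  have hq₀ : ∀ z, q (θ₀ z) = q z := hH₀.proj_eq
  have hq₁ : ∀ z, q (θ₁ z) = q z := hH₁.proj_eq
  let b : C(FiberProduct q, Y) := ⟨fun w => q w.1.1, by fun_prop⟩
  let x₀ : FiberProduct q → Sphere (2 * n + 1) := fun w => c₀.toFiber w.1.1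
  let x₀' : FiberProduct q → Sphere (2 * n + 1) := fun w => c₀.toFiber w.1.2
  let x₁ : FiberProduct q → Sphere (2 * n + 1) := fun w => c₁.toFiber (θ₀ w.1.1)
  let x₁' : FiberProduct q → Sphere (2 * n + 1) := fun w => c₁.toFiber (θ₀ w.1.2)
  have hx₀ : ContinuousOn x₀ {w | τ (b w) < 5} :=
    c₀.continuousOn_toFiber.comp (by fun_prop) fun w hw => hw
  have hx₀' : ContinuousOn x₀' {w | τ (b w) < 5} :=
    c₀.continuousOn_toFiber.comp (by fun_prop) fun w hw =>
      show τ (q w.1.2) < 5 from w.2 ▸ hw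
  have hx₁ : ContinuousOn x₁ {w | 0 < τ (b w)} :=
    c₁.continuousOn_toFiber.comp (by fun_prop) fun w hw =>
      show 0 < τ (q (θ₀ w.1.1)) from (hq₀ w.1.1).symm ▸ hw
  have hx₁' : ContinuousOn x₁' {w | 0 < τ (b w)} :=
    c₁.continuousOn_toFiber.comp (by fun_prop) fun w hw =>
      show 0 < τ (q (θ₀ w.1.2)) from (hq₀ w.1.2).symm ▸ w.2 ▸ hw
  have hτ : Continuous fun w => τ (b w) := by fun_prop
  -- The open sets `V₀` and `V₁` where the fiber coordinates differ.
  have hV₀ : IsOpen {w | τ (b w) < 5 ∧ x₀ w ≠ x₀' w} :=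
    (hx₀.prodMk hx₀').isOpen_inter_preimage (isOpen_lt hτ continuous_const)
      isClosed_diagonal.isOpen_compl
  have hV₁ : IsOpen {w | 0 < τ (b w) ∧ x₁ w ≠ x₁' w} :=
    (hx₁.prodMk hx₁').isOpen_inter_preimage (isOpen_lt continuous_const hτ)
      isClosed_diagonal.isOpen_compl
  -- The open set where the planner near the diagonal works.
  let D₀ : Set (FiberProduct q) := {w | τ (b w) < 5} ∩ {w | ∀ s, seg (x₀ w) (x₀' w) s ≠ 0}
  let Dm : Set (FiberProduct q) := (D₀ ∩ {w | 0 < τ (b w)}) ∩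
    {w | ∀ ks : I × I, mixedPath c₀ c₁ (b w) (x₀ w) (x₀' w) ks.1 ks.2 ≠ 0}
  let D₁ : Set (FiberProduct q) := {w | 0 < τ (b w)} ∩ {w | ∀ s, seg (x₁ w) (x₁' w) s ≠ 0}
  have hD₀ : IsOpen D₀ := by
    refine isOpen_inter_setOf_forall_ne (v := fun z => seg (x₀ z.1) (x₀' z.1) z.2)
      (isOpen_lt hτ continuous_const) ?_ 0
    have h1 : ContinuousOn (fun z : FiberProduct q × I => x₀ z.1) ({w | τ (b w) < 5} ×ˢ Set.univ) :=
      hx₀.comp continuousOn_fst fun z hz => hz.1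
    have h2 : ContinuousOn (fun z : FiberProduct q × I => x₀' z.1) ({w | τ (b w) < 5} ×ˢ Set.univ) :=
      hx₀'.comp continuousOn_fst fun z hz => hz.1
    have hs := continuous_seg.comp_continuousOn (h1.prodMk (h2.prodMk continuousOn_snd))
    exact hs
  have hDm : IsOpen Dm := by
    refine isOpen_inter_setOf_forall_ne (v := fun z : FiberProduct q × I × I =>
      mixedPath c₀ c₁ (b z.1) (x₀ z.1) (x₀' z.1) z.2.1 z.2.2)
      (hD₀.inter (isOpen_lt continuous_const hτ)) ?_ 0
    have hb : ContinuousOn (fun z : FiberProduct q × I × I => b z.1)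
      ((D₀ ∩ {w | 0 < τ (b w)}) ×ˢ Set.univ) := by fun_prop
    have h1 : ContinuousOn (fun z : FiberProduct q × I × I => x₀ z.1)
        ((D₀ ∩ {w | 0 < τ (b w)}) ×ˢ Set.univ) :=
      hx₀.comp continuousOn_fst fun z hz => hz.1.1.1
    have h2 : ContinuousOn (fun z : FiberProduct q × I × I => x₀' z.1)
        ((D₀ ∩ {w | 0 < τ (b w)}) ×ˢ Set.univ) :=
      hx₀'.comp continuousOn_fst fun z hz => hz.1.1.1
    have hp := hb.prodMk (h1.prodMk (h2.prodMk continuousOn_snd))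
    have hmix := (continuousOn_mixedPath c₀ c₁).comp hp
      fun z hz => ⟨⟨hz.1.1.1, hz.1.2⟩, hz.1.1.2 _⟩
    exact hmix
  have hD₁ : IsOpen D₁ := by
    refine isOpen_inter_setOf_forall_ne (v := fun z => seg (x₁ z.1) (x₁' z.1) z.2)
      (isOpen_lt continuous_const hτ) ?_ 0
    have h1 : ContinuousOn (fun z : FiberProduct q × I => x₁ z.1) ({w | 0 < τ (b w)} ×ˢ Set.univ) :=
      hx₁.comp continuousOn_fst fun z hz => hz.1
    have h2 : ContinuousOn (fun z : FiberProduct q × I => x₁' z.1) ({w | 0 < τ (b w)} ×ˢ Set.univ) :=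
      hx₁'.comp continuousOn_fst fun z hz => hz.1
    have hs := continuous_seg.comp_continuousOn (h1.prodMk (h2.prodMk continuousOn_snd))
    exact hs
  let D : Set (FiberProduct q) := {w | (τ (b w) ≤ 3 → w ∈ D₀) ∧
    (2 ≤ τ (b w) → τ (b w) ≤ 3 → w ∈ Dm) ∧ (3 ≤ τ (b w) → w ∈ D₁)}
  have hD : IsOpen D := by
    have : D = ({w | 3 < τ (b w)} ∪ D₀) ∩ (({w | τ (b w) < 2} ∪ {w | 3 < τ (b w)} ∪ Dm) ∩
        ({w | τ (b w) < 3} ∪ D₁)) := by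
      ext w
      simp only [D, Set.mem_ofPred_eq, Set.mem_inter_iff, Set.mem_union, ← not_le]
      tauto
    rw [this]
    exact ((isOpen_lt continuous_const hτ).union hD₀).inter
      ((((isOpen_lt hτ continuous_const).union (isOpen_lt continuous_const hτ)).union hDm).inter
        ((isOpen_lt hτ continuous_const).union hD₁))
  have hθ : ∀ {V : Set (FiberProduct q)} {f g : C(V, Z)},
      FiberwiseHomotopic q (θ₀.comp f) (θ₀.comp g) → FiberwiseHomotopic q f g := fun {V f g} H =>
    ((hH₀.precomp f).trans H).trans (hH₀.precomp g).symm
  refine ⟨![⟨_, hV₀⟩, ⟨_, hV₁⟩, ⟨D, hD⟩], fun w => ?_, fun i => ?_⟩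
  · rcases le_or_gt (τ (b w)) 3 with h | h
    · by_cases hw : x₀ w = x₀' w
      · -- Equal coordinates in the first chart are equal in the second one as well, since
        -- `θ₀` factors through the first chart here.
        have hseg : ∀ s, seg (x₀ w) (x₀' w) s ≠ 0 := fun s => by
          rw [← hw, seg_self]; exact coe_ne_zero _
        have hw₀ : w ∈ D₀ := ⟨show τ (b w) < 5 by linarith, hseg⟩
        have hθ₀' : ∀ z, q z = b w → θ₀ z = c₀.ofFiber (b w, c₀.toFiber z) := fun z hz => by
          rw [hθ₀ z (by rwa [hz]), c₀.deform_one z (show τ (q z) < 5 by rw [hz]; linarith), hz]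
        refine ⟨2, fun _ => hw₀, fun h2 _ => ⟨⟨hw₀, show 0 < τ (b w) by linarith⟩, fun ks => ?_⟩,
          fun h3 => ⟨show 0 < τ (b w) by linarith, fun s => ?_⟩⟩
        · rw [← hw, mixedPath_self]; exact coe_ne_zero _
        · have : x₁ w = x₁' w := by
            simp only [x₁, x₁']
            rw [hθ₀' _ rfl, hθ₀' _ w.2.symm]
            exact congrArg (fun x => c₁.toFiber (c₀.ofFiber (b w, x))) hw
          rw [← this, seg_self]; exact coe_ne_zero _
      · exact ⟨0, show τ (b w) < 5 by linarith, hw⟩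
    · have hpos : 0 < τ (b w) := by linarith
      by_cases hw : x₁ w = x₁' w
      · refine ⟨2, fun h' => absurd h' h.not_ge, fun _ h' => absurd h' h.not_ge,
          fun _ => ⟨hpos, fun s => ?_⟩⟩
        rw [← hw, seg_self]; exact coe_ne_zero _
      · exact ⟨1, hpos, hw⟩
  · fin_cases i
    · exact c₀.fiberwiseHomotopic (fun w => w.2.1) (fun w => w.1.2.symm)
        (x := ⟨_, hx₀.comp_continuous continuous_subtype_val fun w => w.2.1⟩)
        (y := ⟨_, hx₀'.comp_continuous continuous_subtype_val fun w => w.2.1⟩)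
        (fun w => rfl) (fun w => rfl) (homotopic_of_ne fun w => w.2.2)
    · refine hθ (c₁.fiberwiseHomotopic (fun w => ?_) (fun w => ?_)
        (x := ⟨_, hx₁.comp_continuous continuous_subtype_val fun w => w.2.1⟩)
        (y := ⟨_, hx₁'.comp_continuous continuous_subtype_val fun w => w.2.1⟩)
        (fun w => rfl) (fun w => rfl) (homotopic_of_ne fun w => w.2.2))
      · exact (congrArg (0 < τ ·) (hq₀ w.1.1.1)).mpr w.2.1
      · exact (hq₀ _).trans (w.1.2.symm.trans (hq₀ _).symm)
    · refine hθ (((hH₁.precomp _).trans (fiberwiseHomotopic_of_segments c₀ c₁ hθ₀ hθ₁ hq₀ hq₁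
        (fun w => w.1.2.symm) ?_ ?_ ?_)).trans (hH₁.precomp _).symm)
      · exact fun w hw => (w.2.1 hw).2
      · exact fun w hw hw' k s => (w.2.2.1 hw hw').2 (k, s)
      · exact fun w hw => (w.2.2.2 hw).2

end Cover

/-! ### Path lifting -/

section PathLifting

/-- The mapping path space of `q`: points of the source with a path in the target starting at their
image. -/
abbrev MappingPathSpace {Z Y : Type*} [TopologicalSpace Z] [TopologicalSpace Y] (q : C(Z, Y)) :=
  {z : Z × C(I, Y) // z.2 0 = q z.1}

/-- A continuous choice of lifts of paths in the target of `q`, given the starting points of the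
lifts. -/
structure PathLifting {Z Y : Type*} [TopologicalSpace Z] [TopologicalSpace Y] (q : C(Z, Y)) where
  /-- The point at a given time of the chosen lift. -/
  toFun : C(MappingPathSpace q × I, Z)
  toFun_zero : ∀ a, toFun (a, 0) = a.1.1
  proj_toFun : ∀ a s, q (toFun (a, s)) = a.1.2 s

theorem IsHurewiczFibration.nonempty_pathLifting {X Y : Type*} [TopologicalSpace X]
    [TopologicalSpace Y] {p : C(X, Y)} (hp : IsHurewiczFibration p) : Nonempty (PathLifting p) := by
  obtain ⟨G, h0, hG⟩ := hp (MappingPathSpace p)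
    ⟨fun z => z.1.1.2 z.2, by fun_prop⟩ ⟨fun z => z.1.1, by fun_prop⟩ fun a => a.2.symm
  exact ⟨⟨G, h0, fun a s => hG (a, s)⟩⟩

namespace PathLifting

variable {Y Z W V : Type*} [TopologicalSpace Y] [TopologicalSpace Z] [TopologicalSpace W]
  [TopologicalSpace V] {q : C(Z, Y)} (L : PathLifting q)

/-- The lift of a family of paths. -/
def lift (f : C(W, Z)) (γ : C(W × I, Y)) (h : ∀ w, γ (w, 0) = q (f w)) : C(W × I, Z) where
  toFun z := L.toFun (⟨(f z.1, γ.curry z.1), h z.1⟩, z.2)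
  continuous_toFun := by
    have : Continuous fun z : W × I => γ.curry z.1 := γ.curry.continuous.comp continuous_fst
    exact L.toFun.continuous.comp ((Continuous.subtype_mk (by fun_prop) _).prodMk continuous_snd)

theorem lift_zero (f : C(W, Z)) (γ : C(W × I, Y)) (h : ∀ w, γ (w, 0) = q (f w)) (w : W) :
    L.lift f γ h (w, 0) = f w :=
  L.toFun_zero _

theorem proj_lift (f : C(W, Z)) (γ : C(W × I, Y)) (h : ∀ w, γ (w, 0) = q (f w)) (w : W) (s : I) :
    q (L.lift f γ h (w, s)) = γ (w, s) :=
  L.proj_toFun _ _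

theorem lift_congr {f : C(W, Z)} {γ : C(W × I, Y)} {h : ∀ w, γ (w, 0) = q (f w)}
    {f' : C(V, Z)} {γ' : C(V × I, Y)} {h' : ∀ v, γ' (v, 0) = q (f' v)} {w : W} {v : V}
    (hf : f w = f' v) (hγ : ∀ s, γ (w, s) = γ' (v, s)) (s : I) :
    L.lift f γ h (w, s) = L.lift f' γ' h' (v, s) := by
  have : γ.curry w = γ'.curry v := ContinuousMap.ext hγ
  simp only [lift, ContinuousMap.coe_mk]
  congr 3
  exact Prod.ext hf this

end PathLifting

end PathLifting

section EndMap

variable {X Y : Type*} [TopologicalSpace X] [TopologicalSpace Y] (p : C(X, Y))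

/-- The end point of the path; this is the fibration that replaces `p`. -/
def endMap : C(MappingPathSpace p, Y) where
  toFun z := z.1.2 1

/-- Paths are lifted along `endMap` by appending longer and longer initial pieces of them. -/
noncomputable def endMapPathLifting : PathLifting (endMap p) := by
  let c : (MappingPathSpace (endMap p) × I) × I → Y := fun z =>
    if (z.2 : ℝ) * (1 + z.1.2) ≤ 1 then
      z.1.1.1.1.1.2 (Set.projIcc 0 1 zero_le_one ((z.2 : ℝ) * (1 + z.1.2)))
    else z.1.1.1.2 (Set.projIcc 0 1 zero_le_one ((z.2 : ℝ) * (1 + z.1.2) - 1))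
  have hc : Continuous c := by
    refine Continuous.if_le ?_ ?_ (by fun_prop) continuous_const fun z hz => ?_
    · have : Continuous fun z : (MappingPathSpace (endMap p) × I) × I =>
        Set.projIcc (0 : ℝ) 1 zero_le_one ((z.2 : ℝ) * (1 + z.1.2)) :=
        continuous_projIcc.comp (by fun_prop)
      fun_prop
    · have : Continuous fun z : (MappingPathSpace (endMap p) × I) × I =>
        Set.projIcc (0 : ℝ) 1 zero_le_one ((z.2 : ℝ) * (1 + z.1.2) - 1) :=
        continuous_projIcc.comp (by fun_prop)
      fun_prop
    · rw [hz]
      have h : z.1.1.1.2 0 = z.1.1.1.1.1.2 1 := z.1.1.2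
      simpa using h.symm
  let C : C(MappingPathSpace (endMap p) × I, C(I, Y)) := ContinuousMap.curry ⟨c, hc⟩
  have hC0 : ∀ z, C z 0 = p z.1.1.1.1.1 := fun z => by
    have := z.1.1.1.2
    simpa [C, c] using this
  refine ⟨⟨fun z => ⟨(z.1.1.1.1.1, C z), hC0 z⟩, by fun_prop⟩, fun a => ?_, fun a s => ?_⟩
  · refine Subtype.ext (Prod.ext rfl (ContinuousMap.ext fun u => ?_))
    simp [C, c, u.2.2]
  · have h : a.1.2 0 = a.1.1.1.2 1 := a.2
    change c ((a, s), 1) = a.1.2 s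
    rcases eq_or_ne s 0 with rfl | hs
    · simpa [c] using h.symm
    · have : ¬ (1 : ℝ) + s ≤ 1 := by
        have : (0 : ℝ) < s := unitInterval.pos_iff_ne_zero.2 hs
        linarith
      simp [c, this]

end EndMap

/-! ### Charts over sets that are contractible in the base -/

section ExistsChart

variable {Y Z F : Type*} [TopologicalSpace Y] [TopologicalSpace Z] [TopologicalSpace F]

theorem continuousOn_dite {X W : Type*} [TopologicalSpace X] [TopologicalSpace W] {A : Set X}
    [∀ x, Decidable (x ∈ A)] (φ : C(A, W)) (ψ : X → W) :
    ContinuousOn (fun x => if h : x ∈ A then φ ⟨x, h⟩ else ψ x) A := by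
  rw [continuousOn_iff_continuous_domRestrict]
  convert φ.continuous using 1
  ext x
  simp

open Classical in
/-- If the inclusion of `A` is homotopic to the constant map at `y` and the fiber over `y` is
dominated by `F`, then there is a chart over `A` with fiber `F`: transport points to the fiber over
`y` and back along the tracks of the homotopy. -/
theorem nonempty_fiberChart [Nonempty F] {q : C(Z, Y)} (L : PathLifting q) {A : Set Y} {y : Y}
    (hA : (⟨Subtype.val, continuous_subtype_val⟩ : C(A, Y)).Homotopic (.const A y))
    (f : C(F, Z)) (hf : ∀ x, q (f x) = y) (g : C({z // q z = y}, F))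
    (hfg : FiberwiseHomotopic q ⟨Subtype.val, continuous_subtype_val⟩ (f.comp g)) :
    Nonempty (FiberChart q A F) := by
  obtain ⟨K⟩ := hA
  have hK0 : ∀ a, K (0, a) = a := K.apply_zero
  have hK1 : ∀ a, K (1, a) = y := K.apply_one
  obtain ⟨G, hG0, hG1, hGq⟩ := hfg.exists_homotopy
  let b : C(q ⁻¹' A, A) := ⟨fun z => ⟨q z.1, z.2⟩, by fun_prop⟩
  let ι : C(q ⁻¹' A, Z) := ⟨Subtype.val, continuous_subtype_val⟩
  -- Transport along the tracks up to time `r`, and back.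
  let out : C((I × (q ⁻¹' A)) × I, Z) := L.lift ⟨fun w => w.2.1, by fun_prop⟩
    ⟨fun w => K (w.1.1 * w.2, b w.1.2), by fun_prop⟩ fun w => by simp [hK0, b]
  have hout : ∀ w, q (out (w, 1)) = K (w.1, b w.2) := fun w => by
    simp [out, L.proj_lift]
  let back : C((I × (q ⁻¹' A)) × I, Z) := L.lift ⟨fun w => out (w, 1), by fun_prop⟩
    ⟨fun w => K (w.1.1 * σ w.2, b w.1.2), by fun_prop⟩ fun w => by simp [hout]
  have hback : ∀ w, q (back (w, 1)) = q w.2 := fun w => by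
    simp [back, L.proj_lift, hK0, b]
  let T : C(q ⁻¹' A, {z // q z = y}) := ⟨fun z => ⟨out ((1, z), 1), by rw [hout, hK1]⟩, by fun_prop⟩
  let m : C((A × F) × I, Z) := L.lift ⟨fun w => f w.2, by fun_prop⟩
    ⟨fun w => K (σ w.2, w.1.1), by fun_prop⟩ fun w => by simp [hK1, hf]
  have hm : ∀ w, q (m (w, 1)) = w.1 := fun w => by
    simp [m, L.proj_lift, hK0]
  let back' : C((I × (q ⁻¹' A)) × I, Z) := L.lift ⟨fun w => G (w.1, T w.2), by fun_prop⟩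
    ⟨fun w => K (σ w.2, b w.1.2), by fun_prop⟩ fun w => by
      simp only [ContinuousMap.coe_mk, unitInterval.symm_zero, hK1, hGq]
      exact (T w.2).2.symm
  have H : FiberwiseHomotopic q ι ⟨fun z => m ((b z, g (T z)), 1), by fun_prop⟩ := by
    have s1 : FiberwiseHomotopic q ι ⟨fun z => out ((0, z), 1), by fun_prop⟩ :=
      .mk (fun z => out ((0, z.2), z.1)) (by fun_prop) (fun z => L.lift_zero _ _ _ _)
        (fun _ => rfl) fun t z => by simp [out, L.proj_lift, hK0, b, ι]
    have s2 : FiberwiseHomotopic q (W := q ⁻¹' A) ⟨fun z => out ((0, z), 1), by fun_prop⟩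
        ⟨fun z => back ((0, z), 1), by fun_prop⟩ :=
      .mk (fun z => back ((0, z.2), z.1)) (by fun_prop) (fun z => L.lift_zero _ _ _ _)
        (fun _ => rfl) fun t z => by simp [hout, back, L.proj_lift, hK0]
    have s3 : FiberwiseHomotopic q (W := q ⁻¹' A) ⟨fun z => back ((0, z), 1), by fun_prop⟩
        ⟨fun z => back ((1, z), 1), by fun_prop⟩ :=
      .mk (fun z => back (z, 1)) (by fun_prop) (fun _ => rfl) (fun _ => rfl)
        fun t z => by simp [hback]
    have s4 : FiberwiseHomotopic q (W := q ⁻¹' A) ⟨fun z => back ((1, z), 1), by fun_prop⟩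
        ⟨fun z => m ((b z, g (T z)), 1), by fun_prop⟩ := by
      refine .mk (fun z => back' (z, 1)) (by fun_prop) (fun z => ?_) (fun z => ?_) fun t z => ?_
      · refine L.lift_congr (h' := fun v => by simp [hout]) ?_ (fun s => ?_) 1
        · exact hG0 (T z)
        · simp
      · refine L.lift_congr (h' := fun v => by simp [hK1, hf]) ?_ (fun s => ?_) 1
        · exact hG1 (T z)
        · simp
      · simp [hback, back', L.proj_lift, hK0, b]
    exact ((s1.trans s2).trans s3).trans s4
  obtain ⟨H, H0, H1, Hq⟩ := H.exists_homotopy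
  refine ⟨{
    toFiber := fun z => if h : z ∈ q ⁻¹' A then (g.comp T) ⟨z, h⟩ else Classical.arbitrary F
    ofFiber := fun z => if h : z ∈ A ×ˢ (Set.univ : Set F) then m ((⟨z.1, h.1⟩, z.2), 1) else f z.2
    deform := fun z => if h : z ∈ (Set.univ : Set I) ×ˢ (q ⁻¹' A) then H (z.1, ⟨z.2, h.2⟩) else z.2
    continuousOn_toFiber := continuousOn_dite (g.comp T) _
    continuousOn_ofFiber := continuousOn_dite (A := A ×ˢ (Set.univ : Set F))
      ⟨fun z => m ((⟨z.1.1, z.2.1⟩, z.1.2), 1), by fun_prop⟩ _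
    continuousOn_deform := continuousOn_dite (A := (Set.univ : Set I) ×ˢ (q ⁻¹' A))
      ⟨fun z => H (z.1.1, ⟨z.1.2, z.2.2⟩), by fun_prop⟩ _
    proj_ofFiber := fun a ha x => ?_
    proj_deform := fun t z => ?_
    deform_zero := fun z => ?_
    deform_one := fun z hz => ?_ }⟩
  · simp [ha, hm]
  · by_cases h : q z ∈ A
    · simp [h, Hq, ι]
    · simp [h]
  · by_cases h : q z ∈ A
    · simp [h, H0, ι]
    · simp [h]
  · simp [hz, H1, b]

end ExistsChart

/-! ### The suspension -/

section Suspension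

variable {B : Type*} [TopologicalSpace B]

theorem continuous_suspension_mk :
    Continuous (Quot.mk (suspensionRel B) : B × I → Suspension B) :=
  continuous_quot_mk

/-- The height on the suspension, rescaled to run from `-1` to `6`. -/
def height : C(Suspension B, ℝ) where
  toFun := Quot.lift (fun b : B × I => 7 * (b.2 : ℝ) - 1) (by
    rintro x y (⟨h, h'⟩ | ⟨h, h'⟩) <;> simp [h, h'])
  continuous_toFun := continuous_quot_lift _ (by fun_prop)

/-- A selfmap of the interval that preserves the end points acts on the heights of the suspension,
and is homotopic to the identity. -/
theorem exists_suspension_map_homotopic_id (θ : C(I, I)) (h0 : θ 0 = 0) (h1 : θ 1 = 1) :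
    ∃ Θ : C(Suspension B, Suspension B), (ContinuousMap.id _).Homotopic Θ ∧
      ∀ b t, Θ (Quot.mk _ (b, t)) = Quot.mk _ (b, θ t) := by
  let c : I → I → I := fun t s => Set.projIcc 0 1 zero_le_one ((1 - (s : ℝ)) * t + s * θ t)
  have hc : Continuous fun z : I × I => c z.1 z.2 := continuous_projIcc.comp (by fun_prop)
  have hc0 : ∀ s, c 0 s = 0 := fun s => by simp [c, h0]
  have hc1 : ∀ s, c 1 s = 1 := fun s => by simp [c, h1]
  let m : C((B × I) × I, Suspension B) :=
    ⟨fun z => Quot.mk _ (z.1.1, c z.1.2 z.2), continuous_suspension_mk.comp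
      (.prodMk (by fun_prop) (hc.comp (f := fun z : (B × I) × I => (z.1.2, z.2)) (by fun_prop)))⟩
  let M : C(Suspension B, C(I, Suspension B)) :=
    ⟨Quot.lift m.curry (by
      rintro ⟨b, t⟩ ⟨b', t'⟩ (⟨h, h'⟩ | ⟨h, h'⟩) <;> ext s <;> simp only at h h' <;>
        subst h <;> subst h' <;> apply Quot.sound
      · exact Or.inl ⟨hc0 s, hc0 s⟩
      · exact Or.inr ⟨hc1 s, hc1 s⟩), continuous_quot_lift _ m.curry.continuous⟩
  refine ⟨⟨fun z => M z 1, by fun_prop⟩, ⟨⟨⟨fun z => M z.2 z.1, by fun_prop⟩, fun z => ?_,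
    fun z => rfl⟩⟩, fun b t => ?_⟩
  · induction z using Quot.ind with | mk b => ?_
    change Quot.mk _ (b.1, c b.2 0) = Quot.mk _ b
    simp [c]
  · change Quot.mk _ (b, c t 1) = Quot.mk _ (b, θ t)
    simp [c]

theorem suspension_joined [Nonempty B] (z z' : Suspension B) : Joined z z' := by
  have : PathConnectedSpace I := isPathConnected_iff_pathConnectedSpace.1
    ((convex_Icc (0 : ℝ) 1).isPathConnected ⟨0, by simp⟩)
  have key : ∀ (b : B) (t t' : I), Joined (Quot.mk _ (b, t) : Suspension B) (Quot.mk _ (b, t')) :=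
    fun b t t' => (PathConnectedSpace.joined t t').map
      (f := fun t => (Quot.mk _ (b, t) : Suspension B))
      (continuous_suspension_mk.comp (by fun_prop))
  induction z using Quot.ind with | mk z => ?_
  induction z' using Quot.ind with | mk z' => ?_
  have h := key z.1 z.2 0
  have h' := key z'.1 0 z'.2
  have : (Quot.mk _ (z.1, 0) : Suspension B) = Quot.mk _ (z'.1, 0) :=
    Quot.sound (Or.inl ⟨rfl, rfl⟩)
  rw [this] at h
  exact h.trans h'

/-- A subset of a space `Y` equivalent to the suspension has null-homotopic inclusion if a
rescaling of the heights moves its image into a cone point. -/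
theorem homotopic_const_of_height [Nonempty B] {Y : Type*} [TopologicalSpace Y]
    (e : ContinuousMap.HomotopyEquiv Y (Suspension B)) {A : Set Y} (θ : C(I, I)) (h0 : θ 0 = 0)
    (h1 : θ 1 = 1) {i : I} (hi : i = 0 ∨ i = 1)
    (hA : ∀ y ∈ A, ∀ b t, e.toFun y = Quot.mk _ (b, t) → θ t = i) (y : Y) :
    (⟨Subtype.val, continuous_subtype_val⟩ : C(A, Y)).Homotopic (.const A y) := by
  obtain ⟨Θ, hΘ, hmk⟩ := exists_suspension_map_homotopic_id (B := B) θ h0 h1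
  let ι : C(A, Y) := ⟨Subtype.val, continuous_subtype_val⟩
  let v : Suspension B := Quot.mk _ (Classical.arbitrary B, i)
  have s1 : ι.Homotopic ((e.invFun.comp Θ).comp (e.toFun.comp ι)) :=
    (e.left_inv.symm.comp (.refl ι)).trans
      (((ContinuousMap.Homotopic.refl e.invFun).comp hΘ).comp (.refl (e.toFun.comp ι)))
  have s2 : (e.invFun.comp Θ).comp (e.toFun.comp ι) = .const A (e.invFun v) := by
    ext a
    change e.invFun (Θ (e.toFun a)) = e.invFun v
    obtain ⟨⟨b, t⟩, hb⟩ := Quot.exists_rep (e.toFun a)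
    rw [← hb, hmk, hA a a.2 b t hb.symm]
    congr 1
    exact Quot.sound (hi.imp (fun h => ⟨h, h⟩) fun h => ⟨h, h⟩)
  have s3 : Joined (e.invFun v) y := by
    have hj : Joined (e.invFun v) (e.invFun (e.toFun y)) :=
      (suspension_joined v (e.toFun y)).map e.invFun.continuous
    obtain ⟨K⟩ := e.left_inv
    exact hj.trans ⟨K.evalAt y⟩
  refine (s2 ▸ s1).trans ?_
  rcases isEmpty_or_nonempty A with h | h
  · exact (Subsingleton.elim (ContinuousMap.const A (e.invFun v)) (.const A y)) ▸ .refl _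
  · exact ContinuousMap.homotopic_const_iff.2 s3

end Suspension

/-! ### Parametrized topological complexity -/

section TC

variable {X Y Z : Type*} [TopologicalSpace X] [TopologicalSpace Y] [TopologicalSpace Z]

/-- A fiberwise homotopy between the two projections of a set of pairs of points of the mapping path
space gives a right homotopy inverse of the homotopy diagonal. -/
theorem mapTC_le_of_cover {p : C(X, Y)} {k : ℕ}
    {U : Fin (k + 1) → TopologicalSpace.Opens (FiberProduct (endMap p))}
    (hU : ∀ w, ∃ i, w ∈ U i)
    (H : ∀ i, FiberwiseHomotopic (endMap p) (W := U i) ⟨fun w => w.1.1.1, by fun_prop⟩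
      ⟨fun w => w.1.1.2, by fun_prop⟩) : mapTC p ≤ k := by
  let r : C(HomotopyFiberProduct p, FiberProduct (endMap p)) :=
    ⟨fun z => ⟨(⟨(z.1.1, z.1.2.1), z.2.1⟩, ⟨(z.1.2.2, .const I (p z.1.2.2)), rfl⟩), z.2.2⟩, by
      have : Continuous fun z : HomotopyFiberProduct p => ContinuousMap.const I (p z.1.2.2) :=
        ContinuousMap.continuous_const'.comp (by fun_prop)
      fun_prop⟩
  refine iInf₂_le k ⟨fun i => (U i).comap r, fun y => hU (r y), fun i => ?_⟩
  obtain ⟨K, hK0, hK1, hKq⟩ := (H i).exists_homotopy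
  refine ⟨⟨fun z => z.1.1.2.2, by fun_prop⟩, ContinuousMap.Homotopic.symm
    ⟨⟨⟨fun w => ⟨((K (w.1, ⟨r w.2.1, w.2.2⟩)).1.1, (K (w.1, ⟨r w.2.1, w.2.2⟩)).1.2, w.2.1.1.2.2),
      (K (w.1, ⟨r w.2.1, w.2.2⟩)).2, ?_⟩, by fun_prop⟩, fun w => ?_, fun w => ?_⟩⟩⟩
  · exact (hKq w.1 ⟨r w.2.1, w.2.2⟩).trans w.2.1.2.2
  · apply Subtype.ext
    simp only [hK0]
    rfl
  · apply Subtype.ext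
    simp only [hK1]
    rfl

/-- A map `p` that is a fiberwise homotopy retract of `q` inherits the covers by sets over which the
projections of the fiberwise product are fiberwise homotopic. -/
theorem fibrationTC_le_of_cover {p : C(X, Y)} {q : C(Z, Y)} {k : ℕ}
    {U : Fin (k + 1) → TopologicalSpace.Opens (FiberProduct q)} (hU : ∀ w, ∃ i, w ∈ U i)
    (H : ∀ i, FiberwiseHomotopic q (W := U i) ⟨fun w => w.1.1.1, by fun_prop⟩
      ⟨fun w => w.1.1.2, by fun_prop⟩)
    (a : C(X, Z)) (ha : ∀ x, q (a x) = p x) (b : C(Z, X)) (hb : ∀ z, p (b z) = q z)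
    (hba : FiberwiseHomotopic p (.id X) (b.comp a)) : fibrationTC p ≤ k := by
  let r : C(FiberProduct p, FiberProduct q) :=
    ⟨fun z => ⟨(a z.1.1, a z.1.2), by rw [ha, ha, z.2]⟩, by fun_prop⟩
  refine iInf₂_le k ⟨fun i => (U i).comap r, fun y => hU (r y), fun i => ?_⟩
  let u : C((U i).comap r, U i) := ⟨fun z => ⟨r z.1, z.2⟩, by fun_prop⟩
  have h1 := hba.precomp (⟨fun z => z.1.1.1, by fun_prop⟩ : C((U i).comap r, X))
  have h2 := hba.precomp (⟨fun z => z.1.1.2, by fun_prop⟩ : C((U i).comap r, X))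
  obtain ⟨K, hK0, hK1, hKq⟩ :=
    ((h1.trans (((H i).precomp u).postcomp b hb)).trans h2.symm).exists_homotopy
  let K' : C((U i).comap r, C(I, X)) := ContinuousMap.curry ⟨fun z => K (z.2, z.1), by fun_prop⟩
  refine ⟨⟨fun z => ⟨K' z, p z.1.1.1, fun t => hKq t z⟩, by fun_prop⟩, fun z => ?_⟩
  apply Subtype.ext
  exact Prod.ext (hK0 z) (hK1 z)

/-- A fibration is a fiberwise homotopy retract of its mapping path space. -/
theorem fibrationTC_le_of_cover_endMap {p : C(X, Y)} (L : PathLifting p) {k : ℕ}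
    {U : Fin (k + 1) → TopologicalSpace.Opens (FiberProduct (endMap p))}
    (hU : ∀ w, ∃ i, w ∈ U i)
    (H : ∀ i, FiberwiseHomotopic (endMap p) (W := U i) ⟨fun w => w.1.1.1, by fun_prop⟩
      ⟨fun w => w.1.1.2, by fun_prop⟩) : fibrationTC p ≤ k := by
  have hc : Continuous fun x : X => ContinuousMap.const I (p x) :=
    ContinuousMap.continuous_const'.comp p.continuous
  let a : C(X, MappingPathSpace p) := ⟨fun x => ⟨(x, .const I (p x)), rfl⟩, by fun_prop⟩
  refine fibrationTC_le_of_cover hU H a (fun _ => rfl)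
    ⟨fun z => L.toFun (z, 1), by fun_prop⟩ (fun z => L.proj_toFun z 1) ?_
  exact .mk (fun z => L.toFun (a z.2, z.1)) (by fun_prop) (fun x => L.toFun_zero _)
    (fun _ => rfl) fun t x => L.proj_toFun _ _

/-- The charts of the mapping path space of a homotopy fibration. -/
theorem IsHomotopyFibration.exists_nonempty_fiberChart {F : Type*} [TopologicalSpace F]
    [Nonempty F] {j : C(F, X)} {p : C(X, Y)} (hp : IsHomotopyFibration j p) :
    ∃ y : Y, ∀ A : Set Y,
      (⟨Subtype.val, continuous_subtype_val⟩ : C(A, Y)).Homotopic (.const A y) →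
        Nonempty (FiberChart (endMap p) A F) := by
  obtain ⟨y, e, -⟩ := hp
  refine ⟨y, fun A hA => nonempty_fiberChart (endMapPathLifting p) hA
    ⟨fun x => ⟨(e.toFun x).1, (e.toFun x).2.1⟩, by fun_prop⟩ (fun x => (e.toFun x).2.2)
    (e.invFun.comp ⟨fun z => ⟨z.1.1, z.1.2, z.2⟩, by fun_prop⟩) ?_⟩
  obtain ⟨K⟩ := e.right_inv.symm
  refine .mk (fun z => ⟨(K (z.1, ⟨z.2.1.1, z.2.1.2, z.2.2⟩)).1,
    (K (z.1, ⟨z.2.1.1, z.2.1.2, z.2.2⟩)).2.1⟩) (by fun_prop) (fun z => ?_) (fun z => ?_) fun t z => ?_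
  · simp
  · simp
  · exact (K (t, ⟨z.1.1, z.1.2, z.2⟩)).2.2.trans z.2.symm

end TC

end ParamTC

theorem proposition2p6 (n : ℕ) {B Y X : Type*}
    [TopologicalSpace B] [ConnectedSpace B] [TopologicalSpace Y] [TopologicalSpace X]
    (hY : Nonempty (ContinuousMap.HomotopyEquiv Y (ParamTC.Suspension B)))
    (j : C(ParamTC.Sphere (2 * n + 1), X)) (p : C(X, Y))
    (hp : ParamTC.IsHomotopyFibration j p) :
    ParamTC.mapTC p ≤ 2 ∧ (ParamTC.IsHurewiczFibration p → ParamTC.fibrationTC p ≤ 2) := by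
  open ParamTC in
  obtain ⟨e⟩ := hY
  obtain ⟨y, hy⟩ := hp.exists_nonempty_fiberChart
  let τ : C(Y, ℝ) := height.comp e.toFun
  have hτ : ∀ y b t, e.toFun y = Quot.mk _ (b, t) → τ y = 7 * (t : ℝ) - 1 := fun y b t h => by
    change height (e.toFun y) = _
    rw [h]; rfl
  -- The part below height `5` contracts to the lower cone point, by a rescaling of `[-1, 6]` that
  -- is constant on `[-1, 5]`; similarly for the part above height `0`.
  obtain ⟨c₀⟩ := hy {y | τ y < 5} (homotopic_const_of_height e
    ⟨fun t => ramp 5 (7 * (t : ℝ) - 1), by fun_prop⟩ (ramp_of_le (by norm_num))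
    (ramp_of_ge (by norm_num)) (Or.inl rfl)
    (fun y hy b t h => ramp_of_le (by rw [← hτ y b t h]; exact le_of_lt hy)) y)
  obtain ⟨c₁⟩ := hy {y | 0 < τ y} (homotopic_const_of_height e
    ⟨fun t => ramp (-1) (7 * (t : ℝ) - 1), by fun_prop⟩ (ramp_of_le (by norm_num))
    (ramp_of_ge (by norm_num)) (Or.inr rfl)
    (fun y hy b t h => ramp_of_ge (by
      rw [← hτ y b t h]; simpa using le_of_lt (show 0 < τ y from hy))) y)
  obtain ⟨U, hU, H⟩ := exists_cover_of_charts c₀ c₁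
  refine ⟨mapTC_le_of_cover hU H, fun h => ?_⟩
  obtain ⟨L⟩ := h.nonempty_pathLifting
  exact fibrationTC_le_of_cover_endMap L hU H
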